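/- Let $\mathbb S^1=\{(x,y,z)\in\mathbb R^3 : x^2+y^2=1,\ z=0\}$. Let $M$ be a compact smooth surface with boundary (of arbitrary genus; for instance a closed surface of genus $g\ge 1$ with an open disk removed), and let $\Phi:M\to\mathbb R^3$ be an immersion, smooth up to the boundary, which restricts to a smooth embedding of $\partial M$ onto $\mathbb S^1$. For such a $\Phi$ and $p\in\mathbb S^1$ let $co_\Phi(p)$ be the outward unit conormal at $p$, i.e. the unit vector that is tangent to the immersed surface at the boundary point mapped to $p$, orthogonal to its boundary curve, and pointing out of the surface. Let $$G(\Phi)=\int_{\mathbb S^1}\langle \vec k,-co_\Phi\rangle\,d\mathcal H^1$$ be the total geodesic curvature of the boundary, where $\vec k$ is the curvature vector of $\mathbb S^1$ (the second derivative of an arc-length parametrization), so that $\vec k(p)=-p$. Then for every $\varepsilon>0$ there are an open set $U\subset\mathbb R^3$ with $\Phi(M)\subset U$ and a conformal diffeomorphism $F:U\to F(U)\subset\mathbb R^3$ onto an open set such that $F(\mathbb S^1)=\mathbb S^1$ (as a set, not necessarily pointwise), $F\circ\Phi$ is again an immersion, smooth up to the boundary, which restricts to a smooth embedding of $\partial M$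 onto $\mathbb S^1$, and $$\|co_{F\circ\Phi}(p)-p\|_{L^2(\mathbb S^1)}<\varepsilon,\qquad 2\pi-G(F\circ\Phi)<\varepsilon .$$ -/

import Mathlib

open scoped Manifold ContDiff RealInnerProductSpace

noncomputable section

/-- Euclidean three-space. -/
abbrev E3 : Type := EuclideanSpace ℝ (Fin 3)

/-- The unit circle `{(x, y, z) | x² + y² = 1, z = 0}` in three-space. -/
def unitCircle : Set E3 := {p | p 0 ^ 2 + p 1 ^ 2 = 1 ∧ p 2 = 0}

/-- The arc-length parametrization `t ↦ (cos t, sin t, 0)` of the unit circle; it runs once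
through the circle for `t ∈ (0, 2π]`. -/
def circleParam (t : ℝ) : E3 := !₂[Real.cos t, Real.sin t, 0]

section Surface

variable {M : Type*} [TopologicalSpace M] [ChartedSpace (EuclideanHalfSpace 2) M]

/-- The differential of `Φ : M → ℝ³` at `x`, where `M` is a surface with boundary. The tangent
space at `x` is identified with `ℝ²` through the preferred chart at `x`, which takes values in the
half-plane `{u | 0 ≤ u 0}`. -/
def surfaceDiff (Φ : M → E3) (x : M) : EuclideanSpace ℝ (Fin 2) →L[ℝ] E3 :=
  mfderiv (𝓡∂ 2) 𝓘(ℝ, E3) Φ x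

/-- `Φ` is an immersion of the surface with boundary `M` into `ℝ³`, smooth up to the boundary,
that restricts to an embedding of the boundary of `M` onto the unit circle. (A smooth immersion
which is bijective from the compact boundary onto the circle restricts there to a
smooth embedding, and conversely.) -/
structure IsImmersionWithCircleBoundary (Φ : M → E3) : Prop where
  smooth : ContMDiff (𝓡∂ 2) 𝓘(ℝ, E3) ∞ Φ
  immersion : ∀ x, Function.Injective (surfaceDiff Φ x)
  boundary : Set.BijOn Φ ((𝓡∂ 2).boundary M) unitCircle

/-- The unit outward conormal of `Φ` at a boundary point `x`. In the chart at `x` the boundary is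
`{u | u 0 = 0}`; so the vector `e₁` spans the tangent line of the boundary and `e₀` points inwards.
The component of `dΦ(e₀)` orthogonal to `dΦ(e₁)` is tangent to the surface, normal to its boundary
and points inwards; the outward conormal is its negative `w`, normalized. -/
def outwardConormalAt (Φ : M → E3) (x : M) : E3 :=
  let a : E3 := surfaceDiff Φ x (EuclideanSpace.single 0 1)
  let b : E3 := surfaceDiff Φ x (EuclideanSpace.single 1 1)
  let w : E3 := (ℝ ∙ b).starProjection a - a
  ‖w‖⁻¹ • w

open Classical in
/-- The unit outward conormal as a vector field along the boundary curve: its value at `p` is the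
conormal at the boundary point of `M` that is mapped to `p` (the value is `0` off the boundary
curve). -/
def outwardConormal (Φ : M → E3) (p : E3) : E3 :=
  if h : ∃ x ∈ (𝓡∂ 2).boundary M, Φ x = p then outwardConormalAt Φ h.choose else 0

/-- The geodesic curvature `⟨k, -co⟩` of the boundary curve at the point `γ t`, where `γ` is an
arc-length parametrization of the boundary curve, `k = γ''` is its curvature vector and `co` is
the unit outward conormal. -/
def geodesicCurvature (Φ : M → E3) (γ : ℝ → E3) (t : ℝ) : ℝ :=
  ⟪iteratedDeriv 2 γ t, -outwardConormal Φ (γ t)⟫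

/-- The total geodesic curvature of a surface whose boundary is the unit circle: the integral of
the geodesic curvature with respect to arc length. -/
def totalGeodesicCurvature (Φ : M → E3) : ℝ :=
  ∫ t in (0 : ℝ)..(2 * Real.pi), geodesicCurvature Φ circleParam t

/-- The distance in `L²` of the circle, with respect to arc length, between the unit outward
conormal and the radial field `p`. -/
def conormalL2Dist (Φ : M → E3) : ENNReal :=
  MeasureTheory.eLpNorm (fun t : ℝ => outwardConormal Φ (circleParam t) - circleParam t) 2
    (MeasureTheory.volume.restrict (Set.Ioc 0 (2 * Real.pi)))

end Surface

/-- A homeomorphism `F : U → F(U)` between open subsets of `ℝ³` (with `U = F.source` and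
`F(U) = F.target`) is a conformal diffeomorphism: `F` and its inverse are smooth, and the
differential of `F` is at each point of `U` a non-zero multiple of a linear isometry. -/
structure IsConformalDiffeo (F : OpenPartialHomeomorph E3 E3) : Prop where
  smooth : ContDiffOn ℝ ∞ F F.source
  smooth_symm : ContDiffOn ℝ ∞ F.symm F.target
  conformal : ∀ p ∈ F.source, ConformalAt F p

end

/-!
Up to reflections, the conformal maps of space that preserve the unit circle act on the unit normals
of the circle in two ways: they turn the normal circles at all points by a common angle, and they
move the base points by a Möbius transformation of the circle. By `outwardConormal_normal` the
conormal of the surface is a field of unit normals, and by `continuousOn_outwardConormal` it is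
continuous. So one turns it until it is almost radial at the point `(1, 0, 0)`, and then spreads a
small neighbourhood of that point over almost the whole circle: the conormal of the new surface is
almost radial off a short arc. As `k(p) = -p` and all conormals are unit vectors, `2π - G` is the
integral of the defect `1 - ⟨co, p⟩`, and the square of the `L²` distance is twice that integral, so
that both estimates follow from dominated convergence (`tendsto_integral_conormalDefect`).

Concretely, the map `circleMobius a b h` is the composition of two commuting inversions. One is in
the sphere centred at `C = (a, b, 0)`, `|C| > 1`, that is orthogonal to the circle; it sends the
circle to itself, and as `C → (1, 0, 0)` it contracts the circle without the point `(1, 0, 0)` to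
that point. The other is in the sphere centred at `(0, 0, h)` that contains the circle; it fixes the
circle pointwise and reflects its normals, with an angle that depends on `h`. The composition has a
single pole `P = circlePole a b h`, and equals an inversion centred at `P` followed by the
reflection in a plane through `P` (`mirrorInversion`); in this form it is visibly an involution and
a conformal diffeomorphism of the complement of `P`. It pulls the radial field back to `tiltedNormal
h` (`mirrorIsometry_tiltedNormal`).

The pole has to avoid the surface. The image of the surface has Hausdorff dimension at most two, so
its complement is dense (`dense_compl_range_of_contMDiff`), while the parameters that satisfy the
estimates form an open set, whose poles fill an open set: `poleParam` inverts `circlePole`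
(`exists_circlePole_mem`).
-/

open Set Filter Topology MeasureTheory

noncomputable section

/-! ### The conormal spanned by two vectors -/

/-- The unit vector opposite to the component of `a` orthogonal to `b`. It is `0` if `a` is a
multiple of `b`. -/
def conormalOf (a b : E3) : E3 :=
  ‖(ℝ ∙ b).starProjection a - a‖⁻¹ • ((ℝ ∙ b).starProjection a - a)

/-- The conormal depends only on the line spanned by `b` and on the half-plane bounded by this line
that contains `a`. -/
theorem conormalOf_comb (a b : E3) {d c : ℝ} (e : ℝ) (hd : 0 < d) (hc : c ≠ 0) :
    conormalOf (d • a + e • b) (c • b) = conormalOf a b := by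
  have hspan : (ℝ ∙ (c • b)) = ℝ ∙ b := Submodule.span_singleton_smul_eq hc.isUnit b
  have hb : (ℝ ∙ b).starProjection b = b :=
    Submodule.starProjection_eq_self_iff.2 (Submodule.mem_span_singleton_self b)
  have hw : (ℝ ∙ b).starProjection (d • a + e • b) - (d • a + e • b)
      = d • ((ℝ ∙ b).starProjection a - a) := by
    rw [map_add, map_smul, map_smul, hb, smul_sub]; abel
  unfold conormalOf
  simp only [hspan, hw]
  rw [norm_smul, Real.norm_of_nonneg hd.le, smul_smul, mul_inv, mul_comm d⁻¹, mul_assoc,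
    inv_mul_cancel₀ hd.ne', mul_one]

theorem conormalOf_map (A : E3 ≃ₗᵢ[ℝ] E3) (a b : E3) {c : ℝ} (hc : 0 < c) :
    conormalOf (c • A a) (c • A b) = A (conormalOf a b) := by
  have h := conormalOf_comb (A a) (A b) 0 hc hc.ne'
  rw [zero_smul, add_zero] at h
  rw [h]
  have hw : (ℝ ∙ (A b)).starProjection (A a) - A a = A ((ℝ ∙ b).starProjection a - a) := by
    rw [map_sub, Submodule.starProjection_singleton, Submodule.starProjection_singleton]
    simp
  unfold conormalOf
  rw [hw, map_smul, A.norm_map]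

theorem inner_conormalOf_right (a b : E3) : ⟪b, conormalOf a b⟫ = 0 := by
  have h := Submodule.sub_starProjection_mem_orthogonal (K := ℝ ∙ b) a
  have h2 := Submodule.mem_orthogonal_singleton_iff_inner_right.1 h
  unfold conormalOf
  rw [inner_smul_right, ← neg_sub, inner_neg_right, h2]; simp

theorem conormal_vector_ne_zero {a b : E3} (h : LinearIndependent ℝ ![a, b]) :
    (ℝ ∙ b).starProjection a - a ≠ 0 := by
  intro h0
  rw [sub_eq_zero, Submodule.starProjection_eq_self_iff, Submodule.mem_span_singleton] at h0
  obtain ⟨t, ht⟩ := h0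
  have := LinearIndependent.pair_iff.1 h 1 (-t) (by rw [← ht]; simp)
  simp at this

theorem norm_conormalOf {a b : E3} (h : LinearIndependent ℝ ![a, b]) : ‖conormalOf a b‖ = 1 := by
  have := norm_ne_zero_iff.2 (conormal_vector_ne_zero h)
  unfold conormalOf
  rw [norm_smul, norm_inv, norm_norm, inv_mul_cancel₀ this]

theorem continuousWithinAt_conormalOf {X : Type*} [TopologicalSpace X] {f g : X → E3} {s : Set X}
    {x : X}
    (hf : ContinuousWithinAt f s x) (hg : ContinuousWithinAt g s x)
    (h : LinearIndependent ℝ ![f x, g x]) :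
    ContinuousWithinAt (fun y ↦ conormalOf (f y) (g y)) s x := by
  have hb : g x ≠ 0 := h.ne_zero 1
  have hw := conormal_vector_ne_zero h
  have hc : ContinuousWithinAt (fun y ↦ (ℝ ∙ g y).starProjection (f y) - f y) s x := by
    simp only [Submodule.starProjection_singleton]
    have h1 : ContinuousWithinAt (fun y ↦ (⟪g y, f y⟫ : ℝ)) s x := hg.inner hf
    have h2 : ContinuousWithinAt (fun y ↦ ‖g y‖ ^ 2) s x := hg.norm.pow 2
    have h3 : ‖g x‖ ^ 2 ≠ 0 := by simpa using hb
    exact ((h1.div h2 h3).smul hg).sub hf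
  exact (hc.norm.inv₀ (norm_ne_zero_iff.2 hw)).smul hc

/-! ### Conormals in different charts -/

section
variable {M : Type*} [TopologicalSpace M] [ChartedSpace (EuclideanHalfSpace 2) M]

theorem outwardConormalAt_eq (Φ : M → E3) (x : M) :
    outwardConormalAt Φ x = conormalOf (surfaceDiff Φ x (EuclideanSpace.single 0 1))
      (surfaceDiff Φ x (EuclideanSpace.single 1 1)) := rfl

theorem linearIndependent_of_injective {L : EuclideanSpace ℝ (Fin 2) →L[ℝ] E3}
    (h : Function.Injective L) :
    LinearIndependent ℝ ![L (EuclideanSpace.single 0 1), L (EuclideanSpace.single 1 1)] := by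
  rw [LinearIndependent.pair_iff]
  intro s t hst
  rw [← map_smul, ← map_smul, ← map_add] at hst
  have h0 := (map_eq_zero_iff L h).1 hst
  have h1 := congrArg (fun v ↦ v 0) h0
  have h2 := congrArg (fun v ↦ v 1) h0
  simpa using And.intro h1 h2

theorem norm_outwardConormalAt {Φ : M → E3} {x : M} (h : Function.Injective (surfaceDiff Φ x)) :
    ‖outwardConormalAt Φ x‖ = 1 :=
  norm_conormalOf (linearIndependent_of_injective h)

theorem mem_range_halfPlane {u : EuclideanSpace ℝ (Fin 2)} : u ∈ range (𝓡∂ 2) ↔ 0 ≤ u 0 := by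
  rw [range_modelWithCornersEuclideanHalfSpace]; rfl

theorem mem_frontier_halfPlane {u : EuclideanSpace ℝ (Fin 2)} :
    u ∈ frontier (range (𝓡∂ 2)) ↔ u 0 = 0 := by
  rw [frontier_range_modelWithCornersEuclideanHalfSpace]
  exact eq_comm

theorem extChartAt_zero_nonneg (x y : M) : 0 ≤ (extChartAt (𝓡∂ 2) x y) 0 :=
  mem_range_halfPlane.1 (mem_range_self _)

variable [IsManifold (𝓡∂ 2) ∞ M]

/-- Boundary points are recognized in every preferred chart. -/
theorem mem_boundary_iff {x y : M} (hy : y ∈ (chartAt (EuclideanHalfSpace 2) x).source) :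
    y ∈ (𝓡∂ 2).boundary M ↔ (extChartAt (𝓡∂ 2) x y) 0 = 0 := by
  have hr : extChartAt (𝓡∂ 2) x y ∈ range (𝓡∂ 2) := mem_range_self _
  have hint : extChartAt (𝓡∂ 2) x y ∈ interior (extChartAt (𝓡∂ 2) x).target ↔
      extChartAt (𝓡∂ 2) x y ∈ interior (range (𝓡∂ 2)) :=
    ⟨fun h ↦ OpenPartialHomeomorph.interior_extend_target_subset_interior_range _ h,
      fun h ↦ (chartAt (EuclideanHalfSpace 2) x).mem_interior_extend_target
        ((chartAt (EuclideanHalfSpace 2) x).map_source hy) h⟩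
  rw [← mem_frontier_halfPlane, ← not_iff_not]
  refine ((𝓡∂ 2).isInteriorPoint_iff_not_isBoundaryPoint y).symm.trans
    ((ModelWithCorners.isInteriorPoint_iff_of_mem_atlas (I := 𝓡∂ 2) (n := ∞) (by simp)
      (chart_mem_atlas _ x) hy).trans (hint.trans ?_))
  exact mem_interior_iff_notMem_frontier hr

theorem mem_posTangentCone_halfPlane {z v : EuclideanSpace ℝ (Fin 2)} (hz : 0 ≤ z 0)
    (hv : 0 ≤ v 0) : v ∈ posTangentConeAt (range (𝓡∂ 2)) z := by
  apply mem_posTangentConeAt_of_segment_subset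
  intro w hw
  rw [segment_eq_image'] at hw
  obtain ⟨t, ht, rfl⟩ := hw
  rw [mem_range_halfPlane]
  have := mul_nonneg ht.1 hv
  simp; linarith

/-- At a boundary point, the derivative of a change of charts maps inward vectors to inward ones. -/
theorem tangentCoordChange_nonneg {x y : M}
    (hy : y ∈ (chartAt (EuclideanHalfSpace 2) x).source) (hb : y ∈ (𝓡∂ 2).boundary M)
    {v : EuclideanSpace ℝ (Fin 2)} (hv : 0 ≤ v 0) :
    0 ≤ (tangentCoordChange (𝓡∂ 2) x y y v) 0 := by
  have : IsManifold (𝓡∂ 2) 1 M := IsManifold.of_le (n := ∞) (by simp)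
  have hd := hasFDerivWithinAt_tangentCoordChange (I := 𝓡∂ 2) (x := x) (y := y) (z := y)
    ⟨by rwa [extChartAt_source], mem_extChartAt_source y⟩
  have hd0 := ((EuclideanSpace.proj (𝕜 := ℝ) (0 : Fin 2)).hasFDerivAt
    (x := _)).comp_hasFDerivWithinAt _ hd
  have hmin : IsLocalMinOn ((EuclideanSpace.proj (𝕜 := ℝ) (0 : Fin 2)) ∘
      ((extChartAt (𝓡∂ 2) y) ∘ (extChartAt (𝓡∂ 2) x).symm)) (range (𝓡∂ 2))
      (extChartAt (𝓡∂ 2) x y) := by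
    refine Eventually.of_forall fun u ↦ ?_
    have h1 : (extChartAt (𝓡∂ 2) x).symm (extChartAt (𝓡∂ 2) x y) = y :=
      (extChartAt (𝓡∂ 2) x).left_inv (by rwa [extChartAt_source])
    have h2 := (mem_boundary_iff (mem_chart_source _ y)).1 hb
    simp only [Function.comp_apply, h1]
    change (extChartAt (𝓡∂ 2) y y) 0 ≤ _
    rw [h2]
    exact extChartAt_zero_nonneg y _
  exact hmin.hasFDerivWithinAt_nonneg hd0
    (mem_posTangentCone_halfPlane (extChartAt_zero_nonneg x y) hv)

/-- At a boundary point, a change of charts preserves the tangent line of the boundary: `e₁` and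
`-e₁` are both mapped into the closed inner half-plane. -/
theorem tangentCoordChange_single_one {x y : M}
    (hy : y ∈ (chartAt (EuclideanHalfSpace 2) x).source) (hb : y ∈ (𝓡∂ 2).boundary M) :
    (tangentCoordChange (𝓡∂ 2) x y y (EuclideanSpace.single 1 1)) 0 = 0 := by
  have h1 := tangentCoordChange_nonneg hy hb (v := EuclideanSpace.single 1 1) (by simp)
  have h2 := tangentCoordChange_nonneg hy hb (v := -EuclideanSpace.single 1 1) (by simp)
  rw [map_neg] at h2
  simp only [PiLp.neg_apply] at h2
  linarith

theorem eq_smul_single_add_smul_single (v : EuclideanSpace ℝ (Fin 2)) :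
    v = v 0 • EuclideanSpace.single 0 1 + v 1 • EuclideanSpace.single 1 1 := by
  ext i; fin_cases i <;> simp

/-- The conormal at a boundary point may be computed in any preferred chart around the point. -/
theorem outwardConormalAt_eq_of_mem_source (Φ : M → E3) {x y : M}
    (hy : y ∈ (chartAt (EuclideanHalfSpace 2) x).source) (hb : y ∈ (𝓡∂ 2).boundary M) :
    outwardConormalAt Φ y =
      conormalOf
        (surfaceDiff Φ y (tangentCoordChange (𝓡∂ 2) x y y (EuclideanSpace.single 0 1)))
        (surfaceDiff Φ y (tangentCoordChange (𝓡∂ 2) x y y (EuclideanSpace.single 1 1))) := by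
  have : IsManifold (𝓡∂ 2) 1 M := IsManifold.of_le (n := ∞) (by simp)
  set T := tangentCoordChange (𝓡∂ 2) x y y
  set e₀ : EuclideanSpace ℝ (Fin 2) := EuclideanSpace.single 0 1 with he₀
  set e₁ : EuclideanSpace ℝ (Fin 2) := EuclideanSpace.single 1 1 with he₁
  have hs : y ∈ (extChartAt (𝓡∂ 2) x).source := by rwa [extChartAt_source]
  have hsy := mem_extChartAt_source (I := 𝓡∂ 2) y
  have hT (v) : T (tangentCoordChange (𝓡∂ 2) y x y v) = v := by
    rw [tangentCoordChange_comp ⟨⟨hsy, hs⟩, hsy⟩, tangentCoordChange_self hsy]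
  have hT' (v) : tangentCoordChange (𝓡∂ 2) y x y (T v) = v := by
    rw [tangentCoordChange_comp ⟨⟨hs, hsy⟩, hs⟩, tangentCoordChange_self hs]
  have h10 : (T e₁) 0 = 0 := tangentCoordChange_single_one hy hb
  have h00 : 0 ≤ (T e₀) 0 := tangentCoordChange_nonneg hy hb (by simp [e₀])
  have h00' : (T e₀) 0 ≠ 0 := by
    intro h0
    have h := hT e₀
    rw [eq_smul_single_add_smul_single (tangentCoordChange (𝓡∂ 2) y x y e₀), map_add,
      map_smul, map_smul] at h
    have := congrArg (fun v ↦ v 0) h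
    simp only [PiLp.add_apply, PiLp.smul_apply, ← he₀, ← he₁, h0, h10] at this
    simp [e₀] at this
  have h11 : (T e₁) 1 ≠ 0 := by
    intro h0
    have hz : T e₁ = 0 := by rw [eq_smul_single_add_smul_single (T e₁), h10, h0]; simp
    have h := hT' e₁
    rw [hz, map_zero] at h
    have := congrArg (fun v ↦ v 1) h
    simp [e₁] at this
  rw [eq_smul_single_add_smul_single (T e₀), eq_smul_single_add_smul_single (T e₁), h10,
    zero_smul, zero_add, map_add, map_smul, map_smul, map_smul, conormalOf_comb _ _ _ (lt_of_le_of_ne h00 h00'.symm) h11, outwardConormalAt_eq]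

theorem continuousOn_outwardConormalAt {Φ : M → E3} (hΦ : IsImmersionWithCircleBoundary Φ) :
    ContinuousOn (outwardConormalAt Φ) ((𝓡∂ 2).boundary M) := by
  intro x hx
  have : IsManifold (𝓡∂ 2) 1 M := IsManifold.of_le (n := ∞) (by simp)
  set L := inTangentCoordinates (𝓡∂ 2) 𝓘(ℝ, E3) id Φ (surfaceDiff Φ) x with hLd
  have hL : ContinuousAt L x := ((hΦ.smooth x).mfderiv_const (m := 0) (by simp)).continuousAt
  have hsrc : (chartAt (EuclideanHalfSpace 2) x).source ∈ 𝓝 x := chart_source_mem_nhds _ x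
  have hLe : ∀ y ∈ (chartAt (EuclideanHalfSpace 2) x).source, ∀ v,
      L y v = surfaceDiff Φ y (tangentCoordChange (𝓡∂ 2) x y y v) := by
    intro y hy v
    have h := congrArg (fun T ↦ T v) (inTangentCoordinates_eq (I := 𝓡∂ 2) (I' := 𝓘(ℝ, E3)) id Φ
      (surfaceDiff Φ) (x₀ := x) (x := y) hy
      (mem_univ _))
    refine h.trans ?_
    rw [tangentBundleCore_coordChange_model_space]
    rfl
  have key : ContinuousWithinAt (fun y ↦ conormalOf (L y (EuclideanSpace.single 0 1))
      (L y (EuclideanSpace.single 1 1))) ((𝓡∂ 2).boundary M) x := by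
    refine continuousWithinAt_conormalOf (hL.clm_apply continuousAt_const).continuousWithinAt
      (hL.clm_apply continuousAt_const).continuousWithinAt ?_
    apply linearIndependent_of_injective
    intro v w hvw
    rw [hLe x (mem_chart_source _ x), hLe x (mem_chart_source _ x)] at hvw
    have := hΦ.immersion x hvw
    rwa [tangentCoordChange_self (mem_extChartAt_source x),
      tangentCoordChange_self (mem_extChartAt_source x)] at this
  refine key.congr_of_eventuallyEq ?_ ?_
  · filter_upwards [mem_nhdsWithin_of_mem_nhds hsrc, self_mem_nhdsWithin] with y hy hb
    rw [hLe y hy, hLe y hy, outwardConormalAt_eq_of_mem_source Φ hy hb]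
  · rw [hLe x (mem_chart_source _ x), hLe x (mem_chart_source _ x),
      outwardConormalAt_eq_of_mem_source Φ (mem_chart_source _ x) hx]

end

/-! ### The conormal field along the circle -/

section
variable {M : Type*} [TopologicalSpace M] [ChartedSpace (EuclideanHalfSpace 2) M]

theorem outwardConormal_apply {Φ : M → E3} (hΦ : InjOn Φ ((𝓡∂ 2).boundary M)) {x : M}
    (hx : x ∈ (𝓡∂ 2).boundary M) : outwardConormal Φ (Φ x) = outwardConormalAt Φ x := by
  have h : ∃ y ∈ (𝓡∂ 2).boundary M, Φ y = Φ x := ⟨x, hx, rfl⟩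
  rw [outwardConormal, dif_pos h, hΦ h.choose_spec.1 hx h.choose_spec.2]

theorem norm_outwardConormal {Φ : M → E3} (hΦ : IsImmersionWithCircleBoundary Φ) {p : E3}
    (hp : p ∈ unitCircle) : ‖outwardConormal Φ p‖ = 1 := by
  obtain ⟨x, hx, rfl⟩ := hΦ.boundary.surjOn hp
  rw [outwardConormal_apply hΦ.boundary.injOn hx]
  exact norm_outwardConormalAt (hΦ.immersion x)

theorem hasFDerivWithinAt_surfaceDiff {Φ : M → E3} (hΦ : IsImmersionWithCircleBoundary Φ) (x : M) :
    HasFDerivWithinAt (Φ ∘ (extChartAt (𝓡∂ 2) x).symm) (surfaceDiff Φ x) (range (𝓡∂ 2))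
      (extChartAt (𝓡∂ 2) x x) :=
  (((hΦ.smooth x).mdifferentiableAt (by simp)).hasMFDerivAt).2

variable [IsManifold (𝓡∂ 2) ∞ M]

/-- The coordinate vector `e₁` at a boundary point is tangent to the boundary; so its image under
`dΦ` is killed by the derivative of every function that is constant on the circle. -/
theorem fderiv_surfaceDiff_eq_zero {Φ : M → E3} (hΦ : IsImmersionWithCircleBoundary Φ) {x : M}
    (hx : x ∈ (𝓡∂ 2).boundary M) {f : E3 → ℝ} {f' : E3 →L[ℝ] ℝ} (hf : HasFDerivAt f f' (Φ x))
    (hc : ∀ p ∈ unitCircle, ∀ q ∈ unitCircle, f p = f q) :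
    f' (surfaceDiff Φ x (EuclideanSpace.single 1 1)) = 0 := by
  set φ := extChartAt (𝓡∂ 2) x with hφ
  have hz : (φ x) 0 = 0 := (mem_boundary_iff (mem_chart_source _ x)).1 hx
  have hsub : {u : EuclideanSpace ℝ (Fin 2) | u 0 = 0} ⊆ range (𝓡∂ 2) := fun u hu ↦
    mem_range_halfPlane.2 (le_of_eq (Eq.symm hu))
  have hxx : φ.symm (φ x) = x := φ.left_inv (mem_extChartAt_source x)
  have hd : HasFDerivWithinAt (f ∘ (Φ ∘ φ.symm)) (f'.comp (surfaceDiff Φ x))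
      {u : EuclideanSpace ℝ (Fin 2) | u 0 = 0} (φ x) := by
    refine HasFDerivAt.comp_hasFDerivWithinAt _ ?_ ((hasFDerivWithinAt_surfaceDiff hΦ x).mono hsub)
    simpa only [Function.comp_apply, hxx] using hf
  have htan : EuclideanSpace.single 1 1 ∈
      posTangentConeAt {u : EuclideanSpace ℝ (Fin 2) | u 0 = 0} (φ x) := by
    apply mem_posTangentConeAt_of_segment_subset
    intro w hw
    rw [segment_eq_image'] at hw
    obtain ⟨t, ht, rfl⟩ := hw
    simp [hz]
  have hev : ∀ᶠ u in 𝓝[{u : EuclideanSpace ℝ (Fin 2) | u 0 = 0}] (φ x),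
      (f ∘ (Φ ∘ φ.symm)) u = (f ∘ (Φ ∘ φ.symm)) (φ x) := by
    have ht : φ.target ∈ 𝓝[{u : EuclideanSpace ℝ (Fin 2) | u 0 = 0}] (φ x) :=
      nhdsWithin_mono _ hsub (extChartAt_target_mem_nhdsWithin x)
    filter_upwards [ht, self_mem_nhdsWithin] with u hu hu0
    have hus : φ.symm u ∈ (chartAt (EuclideanHalfSpace 2) x).source := by
      rw [← extChartAt_source (𝓡∂ 2)]; exact φ.map_target hu
    have hub : φ.symm u ∈ (𝓡∂ 2).boundary M := by
      rw [mem_boundary_iff hus, ← hφ, φ.right_inv hu]; exact hu0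
    simp only [Function.comp_apply, hxx]
    exact hc _ (hΦ.boundary.mapsTo hub) _ (hΦ.boundary.mapsTo hx)
  have hmin : IsLocalMinOn (f ∘ (Φ ∘ φ.symm)) {u : EuclideanSpace ℝ (Fin 2) | u 0 = 0} (φ x) :=
    hev.mono fun u hu ↦ hu.ge
  have hmax : IsLocalMaxOn (f ∘ (Φ ∘ φ.symm)) {u : EuclideanSpace ℝ (Fin 2) | u 0 = 0} (φ x) :=
    hev.mono fun u hu ↦ hu.le
  exact le_antisymm (hmax.hasFDerivWithinAt_nonpos hd htan) (hmin.hasFDerivWithinAt_nonneg hd htan)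

/-- The conormal is orthogonal to the tangent `(-y, x, 0)` of the circle. -/
theorem outwardConormal_normal {Φ : M → E3} (hΦ : IsImmersionWithCircleBoundary Φ) {p : E3}
    (hp : p ∈ unitCircle) : p 0 * outwardConormal Φ p 1 = p 1 * outwardConormal Φ p 0 := by
  obtain ⟨x, hx, rfl⟩ := hΦ.boundary.surjOn hp
  rw [outwardConormal_apply hΦ.boundary.injOn hx, outwardConormalAt_eq]
  set a := surfaceDiff Φ x (EuclideanSpace.single 0 1)
  set b := surfaceDiff Φ x (EuclideanSpace.single 1 1) with hb
  have hin : ⟪b, conormalOf a b⟫ = 0 := inner_conormalOf_right a b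
  have hb0 : b ≠ 0 := (linearIndependent_of_injective (hΦ.immersion x)).ne_zero 1
  have h2 : b 2 = 0 := fderiv_surfaceDiff_eq_zero hΦ hx
    (EuclideanSpace.proj (𝕜 := ℝ) (2 : Fin 3)).hasFDerivAt (fun p hp q hq ↦ hp.2.trans hq.2.symm)
  have h01 : Φ x 0 * b 0 + Φ x 1 * b 1 = 0 := by
    have hd0 := (EuclideanSpace.proj (𝕜 := ℝ) (0 : Fin 3)).hasFDerivAt (x := Φ x)
    have hd1 := (EuclideanSpace.proj (𝕜 := ℝ) (1 : Fin 3)).hasFDerivAt (x := Φ x)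
    have := fderiv_surfaceDiff_eq_zero hΦ hx ((hd0.mul hd0).add (hd1.mul hd1)) (by
      intro p hp q hq
      have h1 := hp.1
      have h2 := hq.1
      change p 0 * p 0 + p 1 * p 1 = q 0 * q 0 + q 1 * q 1
      linarith)
    simp [← hb] at this
    linarith
  have h1 := hp.1
  have hin' : b 0 * conormalOf a b 0 + b 1 * conormalOf a b 1 = 0 := by
    have := hin
    simp [PiLp.inner_apply, Fin.sum_univ_three, h2] at this
    linarith
  -- `b` is a non-zero multiple `s (-y, x, 0)` of the tangent of the circle at `(x, y, 0)`
  set s := Φ x 0 * b 1 - Φ x 1 * b 0 with hs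
  have e0 : b 0 = -s * Φ x 1 := by rw [hs]; linear_combination (-b 0) * h1 + Φ x 0 * h01
  have e1 : b 1 = s * Φ x 0 := by rw [hs]; linear_combination (-b 1) * h1 + Φ x 1 * h01
  have hs0 : s ≠ 0 := by
    intro h0
    apply hb0
    ext i
    fin_cases i
    · simp [e0, h0]
    · simp [e1, h0]
    · simpa using h2
  rw [e0, e1] at hin'
  apply mul_left_cancel₀ hs0
  linarith

theorem continuousOn_outwardConormal [CompactSpace M] {Φ : M → E3}
    (hΦ : IsImmersionWithCircleBoundary Φ) : ContinuousOn (outwardConormal Φ) unitCircle := by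
  have hcl : IsClosed ((𝓡∂ 2).boundary M) :=
    ModelWithCorners.isClosed_boundary (I := 𝓡∂ 2) (n := ∞) (by simp)
  have : CompactSpace ((𝓡∂ 2).boundary M) := isCompact_iff_compactSpace.1 hcl.isCompact
  let e : (𝓡∂ 2).boundary M ≃ unitCircle := hΦ.boundary.equiv
  have he : Continuous e := (hΦ.smooth.continuous.comp continuous_subtype_val).subtype_mk _
  let E := he.homeoOfEquivCompactToT2
  rw [continuousOn_iff_continuous_domRestrict]
  have h1 := (continuousOn_iff_continuous_domRestrict.1 (continuousOn_outwardConormalAt hΦ)).comp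
    E.symm.continuous
  refine h1.congr fun p ↦ ?_
  have h2 : Φ (E.symm p) = p := congrArg Subtype.val (E.apply_symm_apply p)
  simp only [Function.comp_apply, domRestrict_apply]
  conv_rhs => rw [← h2]
  exact (outwardConormal_apply hΦ.boundary.injOn (E.symm p).2).symm

end

/-! ### Composition with a conformal map -/

section
variable {M : Type*} [TopologicalSpace M] [ChartedSpace (EuclideanHalfSpace 2) M]

theorem surfaceDiff_comp {Φ : M → E3} (hΦ : IsImmersionWithCircleBoundary Φ) {F : E3 → E3} {x : M}
    {F' : E3 →L[ℝ] E3} (hF : HasFDerivAt F F' (Φ x)) (v : EuclideanSpace ℝ (Fin 2)) :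
    surfaceDiff (F ∘ Φ) x v = F' (surfaceDiff Φ x v) := by
  have h := hF.hasMFDerivAt.comp x ((hΦ.smooth x).mdifferentiableAt (by simp)).hasMFDerivAt
  exact congrArg (fun T ↦ T v) h.mfderiv

theorem IsImmersionWithCircleBoundary.comp {Φ : M → E3} (hΦ : IsImmersionWithCircleBoundary Φ)
    {F : E3 → E3} {U : Set E3} (hU : IsOpen U) (hFU : ContDiffOn ℝ ∞ F U) (hΦU : range Φ ⊆ U)
    (hF' : ∀ p ∈ U, ∃ c : ℝ, 0 < c ∧ ∃ A : E3 ≃ₗᵢ[ℝ] E3,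
      HasFDerivAt F (c • (A : E3 →L[ℝ] E3)) p)
    (hbij : BijOn F unitCircle unitCircle) : IsImmersionWithCircleBoundary (F ∘ Φ) where
  smooth x := by
    have h : ContDiffAt ℝ ∞ F (Φ x) :=
      hFU.contDiffAt (hU.mem_nhds (hΦU (mem_range_self x)))
    exact h.contMDiffAt.comp x (hΦ.smooth x)
  immersion x := by
    obtain ⟨c, hc, A, hA⟩ := hF' (Φ x) (hΦU (mem_range_self x))
    intro v w hvw
    rw [surfaceDiff_comp hΦ hA, surfaceDiff_comp hΦ hA] at hvw
    exact hΦ.immersion x (A.injective (smul_right_injective E3 hc.ne' hvw))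
  boundary := hbij.comp hΦ.boundary

theorem outwardConormal_comp {Φ : M → E3} (hΦ : IsImmersionWithCircleBoundary Φ)
    {F : E3 → E3} (hbij : BijOn F unitCircle unitCircle) {p : E3} (hp : p ∈ unitCircle)
    {c : ℝ} (hc : 0 < c) {A : E3 ≃ₗᵢ[ℝ] E3} (hF : HasFDerivAt F (c • (A : E3 →L[ℝ] E3)) p) :
    outwardConormal (F ∘ Φ) (F p) = A (outwardConormal Φ p) := by
  obtain ⟨x, hx, rfl⟩ := hΦ.boundary.surjOn hp
  have h := outwardConormal_apply (hbij.comp hΦ.boundary).injOn hx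
  rw [Function.comp_apply] at h
  rw [h, outwardConormal_apply hΦ.boundary.injOn hx, outwardConormalAt_eq, outwardConormalAt_eq,
    surfaceDiff_comp hΦ hF, surfaceDiff_comp hΦ hF]
  exact conormalOf_map A _ _ hc

end

/-! ### Inversion followed by a reflection in a plane through the centre -/

/-- The inversion with centre `P` and radius `r`, followed by the reflection in the plane through
`P` with normal `n`. -/
def mirrorInversion (P n : E3) (r : ℝ) (x : E3) : E3 :=
  P + (ℝ ∙ n)ᗮ.reflection (EuclideanGeometry.inversion P r x - P)

theorem mirrorInversion_eq (P n : E3) (r : ℝ) (x : E3) :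
    mirrorInversion P n r x = P + (r / dist x P) ^ 2 • (ℝ ∙ n)ᗮ.reflection (x - P) := by
  rw [mirrorInversion, EuclideanGeometry.inversion, vsub_eq_sub, vadd_eq_add, add_sub_cancel_right,
    map_smul]

theorem dist_mirrorInversion (P n : E3) (r : ℝ) (x : E3) :
    dist (mirrorInversion P n r x) P = r ^ 2 / dist x P := by
  rw [mirrorInversion, dist_eq_norm, add_sub_cancel_left, LinearIsometryEquiv.norm_map,
    ← dist_eq_norm, EuclideanGeometry.dist_inversion_center]

theorem mirrorInversion_ne {P n : E3} {r : ℝ} (hr : r ≠ 0) {x : E3} (hx : x ≠ P) :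
    mirrorInversion P n r x ≠ P := by
  rw [← dist_ne_zero, dist_mirrorInversion]
  exact div_ne_zero (pow_ne_zero 2 hr) (dist_ne_zero.2 hx)

theorem mirrorInversion_mirrorInversion {P n : E3} {r : ℝ} (hr : r ≠ 0) {x : E3} (hx : x ≠ P) :
    mirrorInversion P n r (mirrorInversion P n r x) = x := by
  have hd := dist_ne_zero.2 hx
  rw [mirrorInversion_eq P n r (mirrorInversion P n r x), dist_mirrorInversion,
    mirrorInversion_eq P n r x, add_sub_cancel_left, map_smul, Submodule.reflection_reflection,
    smul_smul]
  have : (r / (r ^ 2 / dist x P)) ^ 2 * (r / dist x P) ^ 2 = 1 := by field_simp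
  rw [this, one_smul, add_sub_cancel]

/-- The isometric part of the differential of `mirrorInversion P n r` at `x`. -/
def mirrorIsometry (P n x : E3) : E3 ≃ₗᵢ[ℝ] E3 :=
  ((ℝ ∙ (x - P))ᗮ.reflection).trans (ℝ ∙ n)ᗮ.reflection

theorem hasFDerivAt_mirrorInversion (P n : E3) (r : ℝ) {x : E3} (hx : x ≠ P) :
    HasFDerivAt (mirrorInversion P n r)
      ((r / dist x P) ^ 2 • (mirrorIsometry P n x : E3 →L[ℝ] E3)) x := by
  have h := ((((ℝ ∙ n)ᗮ.reflection : E3 →L[ℝ] E3).hasFDerivAt).comp x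
    ((EuclideanGeometry.hasFDerivAt_inversion (R := r) hx).sub_const P)).const_add P
  refine h.congr_fderiv ?_
  ext1 v
  simp [mirrorIsometry]

theorem contDiffOn_mirrorInversion (P n : E3) (r : ℝ) :
    ContDiffOn ℝ ∞ (mirrorInversion P n r) {P}ᶜ :=
  contDiffOn_const.add (((ℝ ∙ n)ᗮ.reflection : E3 →L[ℝ] E3).contDiff.comp_contDiffOn
    ((contDiffOn_const.inversion contDiffOn_const contDiffOn_id fun _ hx ↦ hx).sub
      contDiffOn_const))

/-- `mirrorInversion` as a homeomorphism of the complement of its pole. It is an involution. -/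
def mirrorInversionHomeomorph (P n : E3) {r : ℝ} (hr : r ≠ 0) : OpenPartialHomeomorph E3 E3 where
  toFun := mirrorInversion P n r
  invFun := mirrorInversion P n r
  source := {P}ᶜ
  target := {P}ᶜ
  map_source' _ hx := mirrorInversion_ne hr hx
  map_target' _ hx := mirrorInversion_ne hr hx
  left_inv' _ hx := mirrorInversion_mirrorInversion hr hx
  right_inv' _ hx := mirrorInversion_mirrorInversion hr hx
  open_source := isOpen_compl_singleton
  open_target := isOpen_compl_singleton
  continuousOn_toFun := (contDiffOn_mirrorInversion P n r).continuousOn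
  continuousOn_invFun := (contDiffOn_mirrorInversion P n r).continuousOn

theorem isConformalDiffeo_mirrorInversion (P n : E3) {r : ℝ} (hr : r ≠ 0) :
    IsConformalDiffeo (mirrorInversionHomeomorph P n hr) where
  smooth := contDiffOn_mirrorInversion P n r
  smooth_symm := contDiffOn_mirrorInversion P n r
  conformal x hx := by
    refine ⟨_, hasFDerivAt_mirrorInversion P n r hx, ?_⟩
    exact (mirrorIsometry P n x).toLinearIsometry.isConformalMap.smul
      (pow_ne_zero 2 (div_ne_zero hr (dist_ne_zero.2 hx)))

theorem reflection_orthogonal_singleton (n v : E3) :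
    (ℝ ∙ n)ᗮ.reflection v = v - (2 * (⟪n, v⟫ / ‖n‖ ^ 2)) • n := by
  rw [Submodule.reflection_orthogonal_apply, Submodule.reflection_singleton_apply]
  simp [mul_smul, two_smul]

/-! ### The involutions that preserve the circle -/

/-- The pole of the composition of two commuting inversions: in the sphere centred at `(a, b, 0)`
that is orthogonal to the circle, and in the sphere centred at `(0, 0, h)` that contains the circle.
Each of them sends the centre of the other sphere to this point. -/
def circlePole (a b h : ℝ) : E3 :=
  !₂[(1 + h ^ 2) * a / (a ^ 2 + b ^ 2 + h ^ 2), (1 + h ^ 2) * b / (a ^ 2 + b ^ 2 + h ^ 2),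
    (a ^ 2 + b ^ 2 - 1) * h / (a ^ 2 + b ^ 2 + h ^ 2)]

/-- The radius of the sphere centred at `circlePole a b h` that contains the intersection of the two
spheres of inversion. -/
def circleRadius (a b h : ℝ) : ℝ :=
  Real.sqrt ((a ^ 2 + b ^ 2 - 1) * (1 + h ^ 2) / (a ^ 2 + b ^ 2 + h ^ 2))

/-- The vector joining the centres of the two spheres of inversion. It is normal to the plane of
their intersection, which passes through `circlePole a b h`. -/
def circleAxis (a b h : ℝ) : E3 := !₂[a, b, -h]

/-- The composition of the inversion in the sphere centred at `(a, b, 0)` orthogonal to the circle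
with the inversion in the sphere centred at `(0, 0, h)` that contains the circle. Defined through
its pole, it is smooth also at the centres of the two spheres. -/
def circleMobius (a b h : ℝ) : E3 → E3 :=
  mirrorInversion (circlePole a b h) (circleAxis a b h) (circleRadius a b h)

/-- The inversion in the sphere centred at `(a, b, 0)` orthogonal to the circle, at a point
`p` of the circle: there the denominator is the squared distance of `p` from `(a, b, 0)`. -/
def circleInversion (a b : ℝ) (p : E3) : E3 :=
  !₂[a + (a ^ 2 + b ^ 2 - 1) / (a ^ 2 + b ^ 2 + 1 - 2 * (a * p 0 + b * p 1)) * (p 0 - a),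
    b + (a ^ 2 + b ^ 2 - 1) / (a ^ 2 + b ^ 2 + 1 - 2 * (a * p 0 + b * p 1)) * (p 1 - b), 0]

/-- The unit normal along the circle of the sphere that `circleMobius a b h` maps to the unit
sphere. It depends on `h` only. -/
def tiltedNormal (h : ℝ) (p : E3) : E3 :=
  !₂[(h ^ 2 - 1) / (1 + h ^ 2) * p 0, (h ^ 2 - 1) / (1 + h ^ 2) * p 1, 2 * h / (1 + h ^ 2)]

theorem norm_circleAxis_sq (a b h : ℝ) : ‖circleAxis a b h‖ ^ 2 = a ^ 2 + b ^ 2 + h ^ 2 := by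
  rw [EuclideanSpace.norm_sq_eq, Fin.sum_univ_three]
  simp [circleAxis]

section
variable {a b : ℝ} (hab : 1 < a ^ 2 + b ^ 2) (h : ℝ)
include hab

theorem circleDist_pos {p : E3} (hp : p ∈ unitCircle) :
    0 < a ^ 2 + b ^ 2 + 1 - 2 * (a * p 0 + b * p 1) := by
  have h1 := hp.1
  have hnn : 0 ≤ (a * p 1 - b * p 0) ^ 2 := sq_nonneg _
  have hq : (a * p 0 + b * p 1) ^ 2 ≤ a ^ 2 + b ^ 2 := by nlinarith
  nlinarith [sq_nonneg (a ^ 2 + b ^ 2 - 1), sq_nonneg (a * p 0 + b * p 1 - 1)]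

theorem circleDenom_pos : 0 < a ^ 2 + b ^ 2 + h ^ 2 := by positivity

theorem circleRadius_pos : 0 < circleRadius a b h := by
  have := circleDenom_pos hab h
  have h1 : 0 < a ^ 2 + b ^ 2 - 1 := by linarith
  exact Real.sqrt_pos.2 (by positivity)

theorem circleRadius_sq : circleRadius a b h ^ 2 =
    (a ^ 2 + b ^ 2 - 1) * (1 + h ^ 2) / (a ^ 2 + b ^ 2 + h ^ 2) := by
  have := circleDenom_pos hab h
  have h1 : 0 < a ^ 2 + b ^ 2 - 1 := by linarith
  exact Real.sq_sqrt (by positivity)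

theorem dist_circlePole_sq {p : E3} (hp : p ∈ unitCircle) : dist p (circlePole a b h) ^ 2 =
    (1 + h ^ 2) * (a ^ 2 + b ^ 2 + 1 - 2 * (a * p 0 + b * p 1)) / (a ^ 2 + b ^ 2 + h ^ 2) := by
  have hD := circleDenom_pos hab h
  rw [EuclideanSpace.dist_eq, Real.sq_sqrt (by positivity)]
  simp only [Real.dist_eq, sq_abs, Fin.sum_univ_three, circlePole, hp.2]
  simp
  field_simp
  linear_combination (a ^ 2 + b ^ 2 + h ^ 2) ^ 2 * hp.1

theorem ne_circlePole {p : E3} (hp : p ∈ unitCircle) : p ≠ circlePole a b h := by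
  have hD := circleDenom_pos hab h
  have hm := circleDist_pos hab hp
  rw [← dist_ne_zero, ← pow_ne_zero_iff two_ne_zero, dist_circlePole_sq hab h hp]
  positivity

/-- On the circle, `circleMobius a b h` has the conformal factor of the inversion in the sphere
centred at `(a, b, 0)`. -/
theorem circleFactor {p : E3} (hp : p ∈ unitCircle) :
    (circleRadius a b h / dist p (circlePole a b h)) ^ 2 =
      (a ^ 2 + b ^ 2 - 1) / (a ^ 2 + b ^ 2 + 1 - 2 * (a * p 0 + b * p 1)) := by
  have hD := circleDenom_pos hab h
  have hm := circleDist_pos hab hp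
  rw [div_pow, dist_circlePole_sq hab h hp, circleRadius_sq hab]
  field_simp

theorem inner_circleAxis_sub_circlePole {p : E3} (hp : p ∈ unitCircle) :
    ⟪circleAxis a b h, p - circlePole a b h⟫ = a * p 0 + b * p 1 - 1 := by
  have hD := circleDenom_pos hab h
  simp [PiLp.inner_apply, Fin.sum_univ_three, circleAxis, circlePole, hp.2]
  field_simp
  ring

/-- On the circle `circleMobius a b h` does not depend on `h`, as the inversion in the sphere
centred at `(0, 0, h)` fixes the circle pointwise. -/
theorem circleMobius_eq {p : E3} (hp : p ∈ unitCircle) :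
    circleMobius a b h p = circleInversion a b p := by
  have hD := circleDenom_pos hab h
  have hm := circleDist_pos hab hp
  rw [circleMobius, mirrorInversion_eq, circleFactor hab h hp, reflection_orthogonal_singleton,
    norm_circleAxis_sq]
  have hin := inner_circleAxis_sub_circlePole hab h hp
  rw [hin]
  ext i
  fin_cases i
  · simp [circlePole, circleAxis, circleInversion]
    field_simp
    ring
  · simp [circlePole, circleAxis, circleInversion]
    field_simp
    ring
  · simp [circlePole, circleAxis, circleInversion, hp.2]
    field_simp
    ring

theorem circleInversion_mem {p : E3} (hp : p ∈ unitCircle) :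
    circleInversion a b p ∈ unitCircle := by
  have hm := circleDist_pos hab hp
  refine ⟨?_, by simp [circleInversion]⟩
  simp [circleInversion]
  field_simp
  linear_combination ((a ^ 2 + b ^ 2 - 1) ^ 2) * hp.1

theorem circleMobius_circleMobius {x : E3} (hx : x ≠ circlePole a b h) :
    circleMobius a b h (circleMobius a b h x) = x :=
  mirrorInversion_mirrorInversion (circleRadius_pos hab h).ne' hx

theorem bijOn_circleMobius : BijOn (circleMobius a b h) unitCircle unitCircle := by
  have hm : MapsTo (circleMobius a b h) unitCircle unitCircle := fun p hp ↦ by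
    rw [circleMobius_eq hab h hp]; exact circleInversion_mem hab hp
  have hi : LeftInvOn (circleMobius a b h) (circleMobius a b h) unitCircle := fun p hp ↦
    circleMobius_circleMobius hab h (ne_circlePole hab h hp)
  exact InvOn.bijOn ⟨hi, hi⟩ hm hm

/-- The differential of `circleMobius a b h` maps the tilted normal to the radial field. -/
theorem mirrorIsometry_tiltedNormal {p : E3} (hp : p ∈ unitCircle) :
    mirrorIsometry (circlePole a b h) (circleAxis a b h) p (tiltedNormal h p) =
      circleMobius a b h p := by
  have hD := circleDenom_pos hab h
  have hm := circleDist_pos hab hp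
  have hh : 0 < 1 + h ^ 2 := by positivity
  rw [circleMobius_eq hab h hp, mirrorIsometry, LinearIsometryEquiv.trans_apply,
    reflection_orthogonal_singleton (p - _), ← dist_eq_norm, dist_circlePole_sq hab h hp]
  rw [reflection_orthogonal_singleton, norm_circleAxis_sq]
  have hin := inner_circleAxis_sub_circlePole hab h hp
  have hin2 : ⟪circleAxis a b h, tiltedNormal h p⟫ =
      ((h ^ 2 - 1) * (a * p 0 + b * p 1) - 2 * h ^ 2) / (1 + h ^ 2) := by
    simp [PiLp.inner_apply, Fin.sum_univ_three, circleAxis, tiltedNormal]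
    field_simp
    ring
  have hin3 : ⟪p - circlePole a b h, tiltedNormal h p⟫ =
      ((h ^ 2 - 1) * (1 - (1 + h ^ 2) * (a * p 0 + b * p 1) / (a ^ 2 + b ^ 2 + h ^ 2))
        - 2 * h ^ 2 * (a ^ 2 + b ^ 2 - 1) / (a ^ 2 + b ^ 2 + h ^ 2)) / (1 + h ^ 2) := by
    simp [PiLp.inner_apply, Fin.sum_univ_three, circlePole, tiltedNormal, hp.2]
    field_simp
    linear_combination (h ^ 2 - 1) * (a ^ 2 + b ^ 2 + h ^ 2) * hp.1
  rw [inner_sub_right, inner_smul_right, hin, hin2, hin3]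
  -- with `S = |C|²` and `q = ⟨C, p⟩` as independent variables the identity is one of rational
  -- functions, coefficient by coefficient in the vectors `p`, `C = (a, b, 0)` and `(0, 0, h)`
  generalize hq : a * p 0 + b * p 1 = q at *
  generalize hS : a ^ 2 + b ^ 2 = S at *
  ext i
  fin_cases i
  · simp [circlePole, circleAxis, circleInversion, tiltedNormal, hq, hS]
    field_simp
    ring
  · simp [circlePole, circleAxis, circleInversion, tiltedNormal, hq, hS]
    field_simp
    ring
  · simp [circlePole, circleAxis, circleInversion, tiltedNormal, hp.2, hq, hS]
    field_simp
    ring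

end

/-! ### The image of a surface has dense complement -/

section
variable {M : Type*} [TopologicalSpace M] [ChartedSpace (EuclideanHalfSpace 2) M]

/-- A compact surface is too small to fill a part of space: its image has Hausdorff dimension at
most two. -/
theorem dense_compl_range_of_contMDiff [CompactSpace M] [IsManifold (𝓡∂ 2) ∞ M] {Φ : M → E3}
    (hΦ : ContMDiff (𝓡∂ 2) 𝓘(ℝ, E3) ∞ Φ) : Dense (range Φ)ᶜ := by
  have hloc : ∀ x : M, ∃ V ∈ 𝓝 x, dimH (Φ '' V) ≤ 2 := by
    intro x
    set φ := extChartAt (𝓡∂ 2) x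
    have hsm : ContDiffOn ℝ 1 (Φ ∘ φ.symm) φ.target := by
      have h := hΦ.comp_contMDiffOn (contMDiffOn_extChartAt_symm (I := 𝓡∂ 2) (n := ∞) x)
      exact (contMDiffOn_iff_contDiffOn.1 h).of_le (by simp)
    obtain ⟨δ, hδ, hδt⟩ := Metric.mem_nhdsWithin_iff.1
      (extChartAt_target_mem_nhdsWithin (I := 𝓡∂ 2) x)
    set s := Metric.ball (φ x) δ ∩ range (𝓡∂ 2)
    have hs : Convex ℝ s := (convex_ball _ _).inter (𝓡∂ 2).convex_range
    refine ⟨φ.source ∩ φ ⁻¹' Metric.ball (φ x) δ, ?_, ?_⟩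
    · exact inter_mem (extChartAt_source_mem_nhds x)
        ((continuousAt_extChartAt x).preimage_mem_nhds (Metric.ball_mem_nhds _ hδ))
    · have hsub : Φ '' (φ.source ∩ φ ⁻¹' Metric.ball (φ x) δ) ⊆ (Φ ∘ φ.symm) '' s := by
        rintro _ ⟨y, ⟨hy, hyb⟩, rfl⟩
        exact ⟨φ y, ⟨hyb, mem_range_self _⟩, by rw [Function.comp_apply, φ.left_inv hy]⟩
      calc dimH (Φ '' (φ.source ∩ φ ⁻¹' Metric.ball (φ x) δ)) ≤ dimH ((Φ ∘ φ.symm) '' s) :=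
            dimH_mono hsub
        _ ≤ dimH s := (hsm.mono hδt).dimH_image_le hs subset_rfl
        _ ≤ dimH (univ : Set (EuclideanSpace ℝ (Fin 2))) := dimH_mono (subset_univ _)
        _ = 2 := by rw [Real.dimH_univ_eq_finrank]; simp
  choose V hV hVd using hloc
  obtain ⟨t, -, ht⟩ := isCompact_univ.elim_nhds_subcover V (fun x _ ↦ hV x)
  apply dense_compl_of_dimH_lt_finrank
  have hsub : range Φ ⊆ ⋃ x ∈ (t : Set M), Φ '' V x := by
    rintro _ ⟨y, rfl⟩
    obtain ⟨x, hx, hy⟩ := mem_iUnion₂.1 (ht (mem_univ y))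
    exact mem_iUnion₂.2 ⟨x, hx, mem_image_of_mem _ hy⟩
  refine (dimH_mono hsub).trans_lt ?_
  rw [dimH_bUnion t.countable_toSet]
  refine (iSup₂_le fun x _ ↦ hVd x).trans_lt ?_
  simp
  norm_num

end

/-! ### The parameters with a given pole -/

/-- The parameters `(a, b, h)` for which `circlePole a b h` is the given point `Q`. Here `k` and `q`
are `|Q|² - 1` and the product of the least and the greatest distance of `Q` from the circle. -/
def poleParam (Q : E3) : ℝ × ℝ × ℝ :=
  let k := Q 0 ^ 2 + Q 1 ^ 2 + Q 2 ^ 2 - 1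
  let q := Real.sqrt (k ^ 2 + 4 * Q 2 ^ 2)
  let g := (k + 2 + q) / (2 * (Q 0 ^ 2 + Q 1 ^ 2))
  (g * Q 0, g * Q 1, 2 * Q 2 / (q - k))

theorem lt_sqrt_poleParam {k z : ℝ} (hz : z ≠ 0) : k < Real.sqrt (k ^ 2 + 4 * z ^ 2) := by
  apply Real.lt_sqrt_of_sq_lt
  have : 0 < z ^ 2 := by positivity
  linarith

theorem circlePole_poleParam {Q : E3} (h0 : Q 0 ^ 2 + Q 1 ^ 2 ≠ 0) (h2 : Q 2 ≠ 0) :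
    circlePole (poleParam Q).1 (poleParam Q).2.1 (poleParam Q).2.2 = Q := by
  have hv := lt_sqrt_poleParam (k := Q 0 ^ 2 + Q 1 ^ 2 + Q 2 ^ 2 - 1) h2
  have hk2 : 0 ≤ (Q 0 ^ 2 + Q 1 ^ 2 + Q 2 ^ 2 - 1) ^ 2 + 4 * Q 2 ^ 2 := by positivity
  have hsq := Real.sq_sqrt hk2
  simp only [poleParam]
  set q := Real.sqrt ((Q 0 ^ 2 + Q 1 ^ 2 + Q 2 ^ 2 - 1) ^ 2 + 4 * Q 2 ^ 2)
  set k := Q 0 ^ 2 + Q 1 ^ 2 + Q 2 ^ 2 - 1 with hk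
  set g := (k + 2 + q) / (2 * (Q 0 ^ 2 + Q 1 ^ 2)) with hg
  have hρ : 0 < Q 0 ^ 2 + Q 1 ^ 2 := lt_of_le_of_ne (by positivity) h0.symm
  have hz : 0 < Q 2 ^ 2 := by positivity
  have hq0 : 0 < q := Real.sqrt_pos.2 (by positivity)
  have huv : (k + 2 + q) * (k + 2 - q) = 4 * (Q 0 ^ 2 + Q 1 ^ 2) := by
    rw [hk] at hsq ⊢; linear_combination -hsq
  have hw : 0 < k + 2 + q := by
    have : -1 ≤ k := by rw [hk]; nlinarith
    linarith
  have hu : 0 < k + 2 - q := by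
    by_contra hcon
    have := mul_nonpos_of_nonneg_of_nonpos hw.le (not_lt.1 hcon)
    linarith
  have hv' : 0 < q - k := by linarith
  have hS : (g * Q 0) ^ 2 + (g * Q 1) ^ 2 = (k + 2 + q) / (k + 2 - q) := by
    rw [mul_pow, mul_pow, ← mul_add, hg]
    generalize Q 0 ^ 2 + Q 1 ^ 2 = R at *
    field_simp
    linear_combination huv
  have hh : (2 * Q 2 / (q - k)) ^ 2 = (q + k) / (q - k) := by
    field_simp
    linear_combination -hsq
  have hg1 : g * (k + 2 - q) = 2 := by
    rw [hg]
    field_simp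
    linear_combination huv
  have hD : (k + 2 + q) / (k + 2 - q) + (q + k) / (q - k) =
      4 * q / ((k + 2 - q) * (q - k)) := by
    field_simp
    ring
  have hc : (1 + (q + k) / (q - k)) / (4 * q / ((k + 2 - q) * (q - k))) = (k + 2 - q) / 2 := by
    field_simp
    ring
  have hc2 : ((k + 2 + q) / (k + 2 - q) - 1) / (4 * q / ((k + 2 - q) * (q - k))) =
      (q - k) / 2 := by
    field_simp
    ring
  ext i
  fin_cases i
  · simp only [circlePole, hS, hh, hD]
    change (1 + (q + k) / (q - k)) * (g * Q 0) / (4 * q / ((k + 2 - q) * (q - k))) = Q 0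
    rw [mul_div_right_comm, hc]
    linear_combination Q 0 / 2 * hg1
  · simp only [circlePole, hS, hh, hD]
    change (1 + (q + k) / (q - k)) * (g * Q 1) / (4 * q / ((k + 2 - q) * (q - k))) = Q 1
    rw [mul_div_right_comm, hc]
    linear_combination Q 1 / 2 * hg1
  · simp only [circlePole, hS, hh, hD]
    change ((k + 2 + q) / (k + 2 - q) - 1) * (2 * Q 2 / (q - k)) /
      (4 * q / ((k + 2 - q) * (q - k))) = Q 2
    rw [mul_div_right_comm, hc2]
    field_simp

theorem poleParam_circlePole {a b h : ℝ} (hab : 1 < a ^ 2 + b ^ 2) (hh : h ≠ 0) :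
    poleParam (circlePole a b h) = (a, b, h) := by
  have hD := circleDenom_pos hab h
  have hS : 0 < a ^ 2 + b ^ 2 - 1 := by linarith
  have hS' : 0 < a ^ 2 + b ^ 2 := by linarith
  have e0 : circlePole a b h 0 = (1 + h ^ 2) * a / (a ^ 2 + b ^ 2 + h ^ 2) := rfl
  have e1 : circlePole a b h 1 = (1 + h ^ 2) * b / (a ^ 2 + b ^ 2 + h ^ 2) := rfl
  have e2 : circlePole a b h 2 = (a ^ 2 + b ^ 2 - 1) * h / (a ^ 2 + b ^ 2 + h ^ 2) := rfl
  have hρ : circlePole a b h 0 ^ 2 + circlePole a b h 1 ^ 2 =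
      (1 + h ^ 2) ^ 2 * (a ^ 2 + b ^ 2) / (a ^ 2 + b ^ 2 + h ^ 2) ^ 2 := by
    rw [e0, e1]; field_simp
  have hk : circlePole a b h 0 ^ 2 + circlePole a b h 1 ^ 2 + circlePole a b h 2 ^ 2 - 1 =
      (a ^ 2 + b ^ 2 - 1) * (h ^ 2 - 1) / (a ^ 2 + b ^ 2 + h ^ 2) := by
    rw [hρ, e2]; field_simp; ring
  have hq : Real.sqrt (((a ^ 2 + b ^ 2 - 1) * (h ^ 2 - 1) / (a ^ 2 + b ^ 2 + h ^ 2)) ^ 2 +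
      4 * ((a ^ 2 + b ^ 2 - 1) * h / (a ^ 2 + b ^ 2 + h ^ 2)) ^ 2) =
      (a ^ 2 + b ^ 2 - 1) * (h ^ 2 + 1) / (a ^ 2 + b ^ 2 + h ^ 2) := by
    rw [Real.sqrt_eq_iff_mul_self_eq (by positivity) (by positivity)]
    ring
  simp only [poleParam]
  rw [hk, hρ, e0, e1, e2, hq]
  have hden : (a ^ 2 + b ^ 2 - 1) * (h ^ 2 + 1) / (a ^ 2 + b ^ 2 + h ^ 2) -
      (a ^ 2 + b ^ 2 - 1) * (h ^ 2 - 1) / (a ^ 2 + b ^ 2 + h ^ 2) =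
      2 * (a ^ 2 + b ^ 2 - 1) / (a ^ 2 + b ^ 2 + h ^ 2) := by
    ring
  have hg : ((a ^ 2 + b ^ 2 - 1) * (h ^ 2 - 1) / (a ^ 2 + b ^ 2 + h ^ 2) + 2 +
      (a ^ 2 + b ^ 2 - 1) * (h ^ 2 + 1) / (a ^ 2 + b ^ 2 + h ^ 2)) /
      (2 * ((1 + h ^ 2) ^ 2 * (a ^ 2 + b ^ 2) / (a ^ 2 + b ^ 2 + h ^ 2) ^ 2)) =
      (a ^ 2 + b ^ 2 + h ^ 2) / (1 + h ^ 2) := by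
    field_simp
    ring
  rw [hden, hg]
  refine Prod.ext ?_ (Prod.ext ?_ ?_)
  · simp only; field_simp
  · simp only; field_simp
  · simp only; field_simp

theorem continuousOn_poleParam :
    ContinuousOn poleParam {Q : E3 | Q 0 ^ 2 + Q 1 ^ 2 ≠ 0 ∧ Q 2 ≠ 0} := by
  intro Q hQ
  have h2 : (2 : ℝ) * (Q 0 ^ 2 + Q 1 ^ 2) ≠ 0 := mul_ne_zero two_ne_zero hQ.1
  have hv := lt_sqrt_poleParam (k := Q 0 ^ 2 + Q 1 ^ 2 + Q 2 ^ 2 - 1) hQ.2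
  have hv' : Real.sqrt ((Q 0 ^ 2 + Q 1 ^ 2 + Q 2 ^ 2 - 1) ^ 2 + 4 * Q 2 ^ 2) -
    (Q 0 ^ 2 + Q 1 ^ 2 + Q 2 ^ 2 - 1) ≠ 0 := by linarith
  apply ContinuousAt.continuousWithinAt
  unfold poleParam
  fun_prop (disch := assumption)

/-- An open set of parameters yields poles that cannot all lie in a set with dense complement. -/
theorem exists_circlePole_mem {D : Set E3} (hD : Dense D) {O : Set (ℝ × ℝ × ℝ)} (hO : IsOpen O)
    {a b h : ℝ} (habh : (a, b, h) ∈ O) (hab : 1 < a ^ 2 + b ^ 2) (hh : h ≠ 0) :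
    ∃ a' b' h' : ℝ, (a', b', h') ∈ O ∧ circlePole a' b' h' ∈ D := by
  have hV : IsOpen {Q : E3 | Q 0 ^ 2 + Q 1 ^ 2 ≠ 0 ∧ Q 2 ≠ 0} := by
    refine IsOpen.inter (isOpen_ne_fun ?_ ?_) (isOpen_ne_fun ?_ ?_) <;> fun_prop
  have hDn := circleDenom_pos hab h
  obtain ⟨Q, ⟨hQV, hQO⟩, hQD⟩ := hD.inter_open_nonempty _
    (continuousOn_poleParam.isOpen_inter_preimage hV hO) ⟨circlePole a b h, by
      constructor
      · have hS : 0 < a ^ 2 + b ^ 2 := by linarith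
        have e : circlePole a b h 0 ^ 2 + circlePole a b h 1 ^ 2 =
            (1 + h ^ 2) ^ 2 * (a ^ 2 + b ^ 2) / (a ^ 2 + b ^ 2 + h ^ 2) ^ 2 := by
          simp [circlePole]; field_simp
        rw [e]
        positivity
      · have hS : a ^ 2 + b ^ 2 - 1 ≠ 0 := by linarith
        exact div_ne_zero (mul_ne_zero hS hh) hDn.ne', by
      rw [mem_preimage, poleParam_circlePole hab hh]; exact habh⟩
  exact ⟨(poleParam Q).1, (poleParam Q).2.1, (poleParam Q).2.2, hQO, by
    rw [circlePole_poleParam hQV.1 hQV.2]; exact hQD⟩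

/-! ### The circle and its normals -/

theorem circleParam_mem (t : ℝ) : circleParam t ∈ unitCircle := by
  refine ⟨?_, by simp [circleParam]⟩
  simp [circleParam]

theorem continuous_circleParam : Continuous circleParam := by
  unfold circleParam
  fun_prop

theorem circleParam_eq (t : ℝ) : circleParam t =
    Real.cos t • EuclideanSpace.single 0 1 + Real.sin t • EuclideanSpace.single 1 1 := by
  ext i
  fin_cases i <;> simp [circleParam]

theorem iteratedDeriv_two_circleParam (t : ℝ) : iteratedDeriv 2 circleParam t = -circleParam t := by
  have h1 : deriv circleParam = fun t ↦
      -Real.sin t • EuclideanSpace.single 0 1 + Real.cos t • EuclideanSpace.single 1 1 := by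
    funext t
    rw [funext circleParam_eq]
    exact (((Real.hasDerivAt_cos t).smul_const _).add
      ((Real.hasDerivAt_sin t).smul_const _)).deriv
  rw [iteratedDeriv_succ, iteratedDeriv_one, h1]
  refine ((((Real.hasDerivAt_sin t).neg.smul_const _).add
    ((Real.hasDerivAt_cos t).smul_const _)).deriv).trans ?_
  rw [circleParam_eq]
  module

theorem norm_of_mem_unitCircle {p : E3} (hp : p ∈ unitCircle) : ‖p‖ = 1 := by
  rw [← sq_eq_sq₀ (norm_nonneg _) zero_le_one, EuclideanSpace.norm_sq_eq, Fin.sum_univ_three]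
  simp [hp.2, hp.1]

theorem norm_tiltedNormal (h : ℝ) {p : E3} (hp : p ∈ unitCircle) : ‖tiltedNormal h p‖ = 1 := by
  rw [← sq_eq_sq₀ (norm_nonneg _) zero_le_one, EuclideanSpace.norm_sq_eq, Fin.sum_univ_three]
  have hh : 0 < 1 + h ^ 2 := by positivity
  simp only [Real.norm_eq_abs, sq_abs, tiltedNormal]
  simp
  field_simp
  linear_combination (h ^ 2 - 1) ^ 2 * hp.1

/-- Every unit vector `(c, s)` is a limit of the stereographic points
`((h² - 1) / (1 + h²), 2 h / (1 + h²))`; only `(1, 0)` is not attained. -/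
theorem exists_stereographic {c s η : ℝ} (hcs : c ^ 2 + s ^ 2 = 1) (hη : 0 < η) :
    ∃ h : ℝ, 1 - (c * ((h ^ 2 - 1) / (1 + h ^ 2)) + s * (2 * h / (1 + h ^ 2))) < η := by
  rcases eq_or_ne c 1 with rfl | hc
  · have hs : s = 0 := by nlinarith
    refine ⟨Real.sqrt (2 / η), ?_⟩
    rw [hs, Real.sq_sqrt (by positivity)]
    have : 1 - (1 * ((2 / η - 1) / (1 + 2 / η)) + 0 * (2 * Real.sqrt (2 / η) / (1 + 2 / η)))
        = η * (2 / (η + 2)) := by field_simp; ring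
    rw [this]
    have h2 : 2 / (η + 2) < 1 := by rw [div_lt_one (by positivity)]; linarith
    nlinarith
  · refine ⟨s / (1 - c), ?_⟩
    have h1c : 1 - c ≠ 0 := sub_ne_zero.2 hc.symm
    have hc1 : c < 1 := lt_of_le_of_ne (by nlinarith [sq_nonneg s]) hc
    have e : (s / (1 - c)) ^ 2 = (1 + c) / (1 - c) := by
      field_simp
      linear_combination hcs
    have e1 : 1 + (1 + c) / (1 - c) = 2 / (1 - c) := by field_simp; ring
    have : 1 - (c * (((1 + c) / (1 - c) - 1) / (2 / (1 - c))) +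
        s * (2 * (s / (1 - c)) / (2 / (1 - c)))) = 0 := by
      field_simp
      linear_combination (-2) * hcs
    rw [e, e1, this]
    exact hη

theorem continuous_tiltedNormal : Continuous fun q : ℝ × E3 ↦ tiltedNormal q.1 q.2 := by
  have (q : ℝ × E3) : 1 + q.1 ^ 2 ≠ 0 := by positivity
  unfold tiltedNormal
  fun_prop (disch := first | assumption | simpa using this)

theorem tendsto_tiltedNormal {α : Type*} {l : Filter α} {f : α → ℝ} {g : α → E3} {h : ℝ} {p : E3}
    (hf : Tendsto f l (𝓝 h)) (hg : Tendsto g l (𝓝 p)) :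
    Tendsto (fun c ↦ tiltedNormal (f c) (g c)) l (𝓝 (tiltedNormal h p)) := by
  have h1 : Tendsto (fun c ↦ (f c, g c)) l (𝓝 (h, p)) := hf.prodMk_nhds hg
  have h2 := continuous_tiltedNormal.tendsto (h, p)
  have h3 := Tendsto.comp h2 h1
  simpa only [Function.comp_def] using h3

/-! ### Concentration at a point -/

theorem continuousOn_circleInversion {a b : ℝ} (hab : 1 < a ^ 2 + b ^ 2) :
    ContinuousOn (circleInversion a b) unitCircle := by
  intro p hp
  have hm := (circleDist_pos hab hp).ne'
  apply ContinuousAt.continuousWithinAt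
  unfold circleInversion
  fun_prop (disch := assumption)

/-- As its centre approaches the point `(1, 0, 0)` of the circle, the inversion of the circle
contracts all other points to `(1, 0, 0)`. -/
theorem tendsto_circleInversion (h : ℝ) {p : E3} (hp : p 0 ≠ 1) :
    Tendsto (fun c : ℝ × ℝ × ℝ ↦ circleInversion c.1 c.2.1 p) (𝓝 (1, 0, h))
      (𝓝 (circleParam 0)) := by
  have hm : (1 : ℝ) ^ 2 + 0 ^ 2 + 1 - 2 * (1 * p 0 + 0 * p 1) ≠ 0 := by
    intro h0
    apply hp
    linarith
  have hc : ContinuousAt (fun c : ℝ × ℝ × ℝ ↦ circleInversion c.1 c.2.1 p) (1, 0, h) := by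
    unfold circleInversion
    fun_prop (disch := assumption)
  have hv : circleInversion 1 0 p = circleParam 0 := by
    ext i
    fin_cases i <;> simp [circleInversion, circleParam]
  have := hc.tendsto
  rwa [hv] at this

section
variable {N : E3 → E3} (hN : ContinuousOn N unitCircle) (hN1 : ∀ p ∈ unitCircle, ‖N p‖ = 1)

/-- The defect `1 - ⟨N, ν⟩` at the point that the involution with parameters `(a, b, h)` sends to
`circleParam t`, where `ν` is the tilted normal. -/
def conormalDefect (N : E3 → E3) (c : ℝ × ℝ × ℝ) (t : ℝ) : ℝ :=
  1 - ⟪N (circleInversion c.1 c.2.1 (circleParam t)),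
    tiltedNormal c.2.2 (circleInversion c.1 c.2.1 (circleParam t))⟫

include hN in
theorem continuous_conormalDefect {c : ℝ × ℝ × ℝ} (hc : 1 < c.1 ^ 2 + c.2.1 ^ 2) :
    Continuous (conormalDefect N c) := by
  have hJ : Continuous fun t ↦ circleInversion c.1 c.2.1 (circleParam t) :=
    (continuousOn_circleInversion hc).comp_continuous continuous_circleParam circleParam_mem
  have hNJ := hN.comp_continuous hJ fun t ↦ circleInversion_mem hc (circleParam_mem t)
  exact continuous_const.sub (hNJ.inner (continuous_tiltedNormal.comp (continuous_const.prodMk hJ)))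

include hN1 in
theorem conormalDefect_mem {c : ℝ × ℝ × ℝ} (hc : 1 < c.1 ^ 2 + c.2.1 ^ 2) (t : ℝ) :
    conormalDefect N c t ∈ Icc 0 2 := by
  have hm := circleInversion_mem hc (circleParam_mem t)
  have h := abs_real_inner_le_norm (N (circleInversion c.1 c.2.1 (circleParam t)))
    (tiltedNormal c.2.2 (circleInversion c.1 c.2.1 (circleParam t)))
  rw [hN1 _ hm, norm_tiltedNormal _ hm, mul_one] at h
  have := abs_le.1 h
  unfold conormalDefect
  constructor <;> linarith

include hN hN1 in
theorem tendsto_integral_conormalDefect (h : ℝ) :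
    Tendsto (fun c ↦ ∫ t in (0 : ℝ)..(2 * Real.pi), conormalDefect N c t)
      (𝓝[{c | 1 < c.1 ^ 2 + c.2.1 ^ 2}] (1, 0, h))
      (𝓝 (2 * Real.pi * (1 - ⟪N (circleParam 0), tiltedNormal h (circleParam 0)⟫))) := by
  have hconst : 2 * Real.pi * (1 - ⟪N (circleParam 0), tiltedNormal h (circleParam 0)⟫) =
      ∫ t in (0 : ℝ)..(2 * Real.pi), (1 - ⟪N (circleParam 0), tiltedNormal h (circleParam 0)⟫) := by
    rw [intervalIntegral.integral_const]; simp
  rw [hconst]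
  refine intervalIntegral.tendsto_integral_filter_of_dominated_convergence (fun _ ↦ 2) ?_ ?_
    intervalIntegrable_const ?_
  · filter_upwards [self_mem_nhdsWithin] with c hc
    exact (continuous_conormalDefect hN hc).aestronglyMeasurable
  · filter_upwards [self_mem_nhdsWithin] with c hc
    refine Eventually.of_forall fun t _ ↦ ?_
    have := conormalDefect_mem hN1 hc t
    rw [Real.norm_of_nonneg this.1]
    exact this.2
  · have hne : ∀ᵐ t : ℝ, t ≠ 2 * Real.pi := by simp [ae_iff, measure_singleton]
    filter_upwards [hne] with t ht htm
    rw [uIoc_of_le (by positivity)] at htm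
    have hp : circleParam t 0 ≠ 1 := by
      intro h1
      have h1' : Real.cos t = 1 := h1
      rw [Real.cos_eq_one_iff_of_lt_of_lt (by linarith [htm.1, Real.pi_pos])
        (lt_of_le_of_ne htm.2 ht)] at h1'
      exact htm.1.ne' h1'
    have hJ : Tendsto (fun c : ℝ × ℝ × ℝ ↦ circleInversion c.1 c.2.1 (circleParam t))
        (𝓝[{c | 1 < c.1 ^ 2 + c.2.1 ^ 2}] (1, 0, h)) (𝓝[unitCircle] (circleParam 0)) := by
      refine tendsto_nhdsWithin_iff.2
        ⟨(tendsto_circleInversion h hp).mono_left nhdsWithin_le_nhds, ?_⟩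
      filter_upwards [self_mem_nhdsWithin] with c hc
      exact circleInversion_mem hc (circleParam_mem t)
    have hNJ : Tendsto (fun c : ℝ × ℝ × ℝ ↦ N (circleInversion c.1 c.2.1 (circleParam t)))
        (𝓝[{c | 1 < c.1 ^ 2 + c.2.1 ^ 2}] (1, 0, h)) (𝓝 (N (circleParam 0))) :=
      (hN _ (circleParam_mem 0)).tendsto.comp hJ
    have hν : Tendsto (fun c : ℝ × ℝ × ℝ ↦
        tiltedNormal c.2.2 (circleInversion c.1 c.2.1 (circleParam t)))
        (𝓝[{c | 1 < c.1 ^ 2 + c.2.1 ^ 2}] (1, 0, h)) (𝓝 (tiltedNormal h (circleParam 0))) := by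
      have hh : Tendsto (fun c : ℝ × ℝ × ℝ ↦ c.2.2)
          (𝓝[{c | 1 < c.1 ^ 2 + c.2.1 ^ 2}] (1, 0, h)) (𝓝 h) :=
        ((continuous_snd.comp continuous_snd).tendsto' _ _ rfl).mono_left nhdsWithin_le_nhds
      exact tendsto_tiltedNormal hh (tendsto_nhds_of_tendsto_nhdsWithin hJ)
    exact tendsto_const_nhds.sub (hNJ.inner hν)

include hN hN1 in
/-- The total defect is small for a non-empty open set of parameters. The condition `c.2.2 ≠ 0`
keeps the pole off the plane `z = 0`, as `exists_circlePole_mem` asks. -/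
theorem exists_isOpen_integral_conormalDefect_lt
    (hN0 : ∀ p ∈ unitCircle, p 0 * N p 1 = p 1 * N p 0) {ε : ℝ} (hε : 0 < ε) :
    ∃ O : Set (ℝ × ℝ × ℝ), IsOpen O ∧ (∃ c ∈ O, c.2.2 ≠ 0) ∧
      ∀ c ∈ O, 1 < c.1 ^ 2 + c.2.1 ^ 2 ∧
        ∫ t in (0 : ℝ)..(2 * Real.pi), conormalDefect N c t < ε := by
  have hmem := circleParam_mem 0
  have e0 : circleParam 0 0 = 1 := by simp [circleParam]
  have e1 : circleParam 0 1 = 0 := by simp [circleParam]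
  have hy : N (circleParam 0) 1 = 0 := by
    have := hN0 _ hmem
    rwa [e0, e1, one_mul, zero_mul] at this
  have hcs : N (circleParam 0) 0 ^ 2 + N (circleParam 0) 2 ^ 2 = 1 := by
    have := hN1 _ hmem
    rw [← sq_eq_sq₀ (norm_nonneg _) zero_le_one, EuclideanSpace.norm_sq_eq,
      Fin.sum_univ_three] at this
    simpa [hy] using this
  obtain ⟨h, hh⟩ := exists_stereographic hcs (η := ε / (2 * Real.pi)) (by positivity)
  have hin : ⟪N (circleParam 0), tiltedNormal h (circleParam 0)⟫ =
      N (circleParam 0) 0 * ((h ^ 2 - 1) / (1 + h ^ 2)) +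
        N (circleParam 0) 2 * (2 * h / (1 + h ^ 2)) := by
    simp [PiLp.inner_apply, Fin.sum_univ_three, tiltedNormal, hy, e0]
    ring
  have hlim : 2 * Real.pi * (1 - ⟪N (circleParam 0), tiltedNormal h (circleParam 0)⟫) < ε := by
    rw [hin]
    rwa [lt_div_iff₀' (by positivity)] at hh
  obtain ⟨v, hv, hvs⟩ := (eventually_nhdsWithin_iff.1
    ((tendsto_integral_conormalDefect hN hN1 h).eventually_lt_const hlim)).exists_mem
  obtain ⟨u, huv, huo, hu⟩ := mem_nhds_iff.1 hv
  have hS : IsOpen {c : ℝ × ℝ × ℝ | 1 < c.1 ^ 2 + c.2.1 ^ 2} :=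
    isOpen_lt (by fun_prop) (by fun_prop)
  refine ⟨u ∩ {c | 1 < c.1 ^ 2 + c.2.1 ^ 2}, huo.inter hS, ?_, fun c hc ↦
    ⟨hc.2, hvs c (huv hc.1) hc.2⟩⟩
  -- the point `(1, 0, h)` itself is excluded; approach it along `(1 + δ, 0, h + δ)`
  have hpath : Tendsto (fun δ : ℝ ↦ ((1 + δ, 0, h + δ) : ℝ × ℝ × ℝ)) (𝓝[>] 0) (𝓝 (1, 0, h)) := by
    have : Continuous (fun δ : ℝ ↦ ((1 + δ, 0, h + δ) : ℝ × ℝ × ℝ)) := by fun_prop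
    exact (this.tendsto' 0 _ (by simp)).mono_left nhdsWithin_le_nhds
  have hne : ∀ᶠ δ : ℝ in 𝓝[>] 0, δ ≠ -h := by
    rcases eq_or_ne h 0 with rfl | hh0
    · filter_upwards [self_mem_nhdsWithin] with δ hδ
      simpa using (mem_Ioi.1 hδ).ne'
    · exact eventually_nhdsWithin_of_eventually_nhds
        (isOpen_ne.mem_nhds (by simpa using hh0 : (0 : ℝ) ≠ -h))
  obtain ⟨δ, hδu, hδ0, hδ⟩ := ((hpath.eventually (huo.mem_nhds hu)).and
    ((eventually_mem_nhdsWithin).and hne)).exists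
  refine ⟨_, ⟨hδu, ?_⟩, fun h0 ↦ hδ (by simp only at h0; linarith)⟩
  have := mem_Ioi.1 hδ0
  simp only [mem_ofPred_eq]
  nlinarith

end

/-! ### The radial component of the conormal -/

section
variable {M : Type*} [TopologicalSpace M] [ChartedSpace (EuclideanHalfSpace 2) M]

theorem IsImmersionWithCircleBoundary.circleMobius_comp {Φ : M → E3}
    (hΦ : IsImmersionWithCircleBoundary Φ) {a b h : ℝ} (hab : 1 < a ^ 2 + b ^ 2)
    (hP : circlePole a b h ∉ range Φ) :
    IsImmersionWithCircleBoundary (circleMobius a b h ∘ Φ) := by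
  refine hΦ.comp isOpen_compl_singleton
    (contDiffOn_mirrorInversion (circlePole a b h) (circleAxis a b h) (circleRadius a b h))
    (subset_compl_singleton_iff.2 hP) (fun p hp ↦ ?_) (bijOn_circleMobius hab h)
  exact ⟨_, pow_pos (div_pos (circleRadius_pos hab h) (dist_pos.2 hp)) 2, _,
    hasFDerivAt_mirrorInversion _ _ _ hp⟩

/-- The radial component of the conormal after the conformal map is the component of the original
conormal along the pulled back radial field, the tilted normal. -/
theorem inner_outwardConormal_circleMobius {Φ : M → E3} (hΦ : IsImmersionWithCircleBoundary Φ)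
    {a b h : ℝ} (hab : 1 < a ^ 2 + b ^ 2) (t : ℝ) :
    ⟪outwardConormal (circleMobius a b h ∘ Φ) (circleParam t), circleParam t⟫ =
      1 - conormalDefect (outwardConormal Φ) (a, b, h) t := by
  have hq := circleParam_mem t
  have hp := circleInversion_mem hab hq
  have hFp : circleMobius a b h (circleInversion a b (circleParam t)) = circleParam t := by
    rw [← circleMobius_eq hab h hq, circleMobius_circleMobius hab h (ne_circlePole hab h hq)]
  set p := circleInversion a b (circleParam t) with hpd
  have hne := ne_circlePole hab h hp
  have hco := outwardConormal_comp hΦ (bijOn_circleMobius hab h) hp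
    (pow_pos (div_pos (circleRadius_pos hab h) (dist_pos.2 hne)) 2)
    (hasFDerivAt_mirrorInversion _ (circleAxis a b h) _ hne)
  have hν := mirrorIsometry_tiltedNormal hab h hp
  rw [hFp] at hco hν
  rw [hco]
  conv_lhs => rw [← hν]
  rw [LinearIsometryEquiv.inner_map_map, conormalDefect, sub_sub_cancel, ← hpd]

/-- The curvature vector of the circle is `-p`, so that the geodesic curvature is the radial
component of the conormal. -/
theorem totalGeodesicCurvature_eq {Ψ : M → E3} {d : ℝ → ℝ} (hd : Continuous d)
    (h : ∀ t, ⟪outwardConormal Ψ (circleParam t), circleParam t⟫ = 1 - d t) :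
    totalGeodesicCurvature Ψ = 2 * Real.pi - ∫ t in (0 : ℝ)..(2 * Real.pi), d t := by
  have hg (t : ℝ) : geodesicCurvature Ψ circleParam t = 1 - d t := by
    rw [geodesicCurvature, iteratedDeriv_two_circleParam, inner_neg_neg, real_inner_comm, h]
  simp only [totalGeodesicCurvature, hg]
  rw [intervalIntegral.integral_sub intervalIntegrable_const (hd.intervalIntegrable _ _)]
  simp

/-- For unit vectors `|co - p|² = 2 (1 - ⟨co, p⟩)`. -/
theorem conormalL2Dist_eq {Ψ : M → E3} (hΨ : IsImmersionWithCircleBoundary Ψ) {d : ℝ → ℝ}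
    (hd : Continuous d)
    (h : ∀ t, ⟪outwardConormal Ψ (circleParam t), circleParam t⟫ = 1 - d t) :
    conormalL2Dist Ψ =
      ENNReal.ofReal (Real.sqrt (2 * ∫ t in (0 : ℝ)..(2 * Real.pi), d t)) := by
  have hnorm (t : ℝ) : ‖outwardConormal Ψ (circleParam t) - circleParam t‖ ^ 2 = 2 * d t := by
    rw [norm_sub_sq_real, norm_outwardConormal hΨ (circleParam_mem t),
      norm_of_mem_unitCircle (circleParam_mem t), h]
    ring
  have hd0 (t : ℝ) : 0 ≤ 2 * d t := (hnorm t) ▸ sq_nonneg _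
  have henorm (t : ℝ) : ‖outwardConormal Ψ (circleParam t) - circleParam t‖ₑ ^ (2 : ℝ) =
      ENNReal.ofReal (2 * d t) := by
    rw [← hnorm, ← ofReal_norm, ENNReal.ofReal_pow (norm_nonneg _)]
    norm_cast
  have hi : IntegrableOn (fun t ↦ 2 * d t) (Ioc 0 (2 * Real.pi)) :=
    ((hd.const_mul 2).integrableOn_Icc).mono_set Ioc_subset_Icc_self
  rw [conormalL2Dist, eLpNorm_eq_lintegral_rpow_enorm_toReal (by simp) (by simp)]
  simp only [ENNReal.toReal_ofNat, henorm]
  rw [← ofReal_integral_eq_lintegral_ofReal hi (Eventually.of_forall hd0),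
    ← intervalIntegral.integral_of_le (by positivity), intervalIntegral.integral_const_mul,
    Real.sqrt_eq_rpow, ENNReal.ofReal_rpow_of_nonneg _ (by norm_num)]
  rw [← intervalIntegral.integral_const_mul]
  exact intervalIntegral.integral_nonneg (by positivity) fun t _ ↦ hd0 t

end

end

theorem mainTheorem6 {M : Type*} [TopologicalSpace M] [T2Space M] [CompactSpace M]
    [ChartedSpace (EuclideanHalfSpace 2) M] [IsManifold (𝓡∂ 2) ∞ M]
    (Φ : M → E3) (hΦ : IsImmersionWithCircleBoundary Φ) (ε : ℝ) (hε : 0 < ε) :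
    ∃ F : OpenPartialHomeomorph E3 E3,
      IsConformalDiffeo F ∧
      Set.range Φ ⊆ F.source ∧
      F '' unitCircle = unitCircle ∧
      IsImmersionWithCircleBoundary (F ∘ Φ) ∧
      conormalL2Dist (F ∘ Φ) < ENNReal.ofReal ε ∧
      2 * Real.pi - totalGeodesicCurvature (F ∘ Φ) < ε := by
  have hN := continuousOn_outwardConormal hΦ
  obtain ⟨O, hO, ⟨⟨a₀, b₀, h₀⟩, hc₀, hh₀⟩, hOlt⟩ := exists_isOpen_integral_conormalDefect_lt hN
    (fun p hp ↦ norm_outwardConormal hΦ hp) (fun p hp ↦ outwardConormal_normal hΦ hp)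
    (lt_min hε (half_pos (pow_pos hε 2)))
  obtain ⟨a, b, h, hO', hP⟩ := exists_circlePole_mem (dense_compl_range_of_contMDiff hΦ.smooth) hO
    hc₀ (hOlt _ hc₀).1 hh₀
  obtain ⟨hab, hlt⟩ := hOlt _ hO'
  have hΨ := hΦ.circleMobius_comp hab hP
  have hd := continuous_conormalDefect hN hab
  have hin := inner_outwardConormal_circleMobius (h := h) hΦ hab
  refine ⟨mirrorInversionHomeomorph (circlePole a b h) (circleAxis a b h)
    (circleRadius_pos hab h).ne', isConformalDiffeo_mirrorInversion _ _ _,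
    subset_compl_singleton_iff.2 hP, (bijOn_circleMobius hab h).image_eq, hΨ, ?_, ?_⟩
  · refine (conormalL2Dist_eq hΨ hd hin).trans_lt ((ENNReal.ofReal_lt_ofReal_iff hε).2 ?_)
    rw [Real.sqrt_lt' hε]
    linarith [hlt.trans_le (min_le_right _ _)]
  · refine (congrArg (fun x ↦ 2 * Real.pi - x) (totalGeodesicCurvature_eq hd hin)).trans_lt ?_
    rw [sub_sub_cancel]
    exact hlt.trans_le (min_le_left _ _)
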